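/- Let $n\ge 1$ and let $y_i=\mu_i^*+\epsilon_i$, $i=1,\dots,n$, with $\mu^*\in\mathbb R^n$ and $\epsilon_1,\dots,\epsilon_n$ i.i.d. $N(0,\sigma^2)$, $\sigma>0$; write $Y=(y_1,\dots,y_n)^T$. Let $A\in\mathbb R^{n\times n}$ have entries $A_{ij}=1$ for $i\ge j$ and $0$ otherwise, put $\theta^*=A^{-1}\mu^*$ (that is, $\theta_1^*=\mu_1^*$ and $\theta_i^*=\mu_i^*-\mu_{i-1}^*$ for $i\ge 2$) and $\tilde\theta^*=(\theta_2^*,\dots,\theta_n^*)^T$. Let $X\in\mathbb R^{n\times(n-1)}$ have entries $x_{ij}=1$ for $i>j$ and $0$ for $i\le j$, let $\bar X$ be the row vector of its column averages, let $\tilde X$ be $X$ with each column centered by its average, and let $\tilde Y=Y-\bar Y$, where $\bar Y$ is the average of the entries of $Y$. For $b\in\mathbb R^{n-1}$ put $\hat\mu(Y,b)=A\,[\hat\theta_1,b]$ with $\hat\theta_1=\bar Y-\bar X b$. (i) For every $Y\in\mathbb R^n$ and $\lambda_2\ge 0$, a vector $\mu$ minimizes the fused Lasso signal approximator objective with $\lambda_1=0$,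 namely $\frac12\|Y-\mu\|_2^2+\lambda_2\sum_{i=1}^{n-1}|\mu_{i+1}-\mu_i|$, if and only if $\mu=\hat\mu(Y,b)$ for some minimizer $b$ of $\frac12\|\tilde Y-\tilde X b\|_2^2+\lambda_2\|b\|_1$. (ii) $\tilde X$ has a singular value decomposition $\tilde X=UDV^T$ with $U\in\mathbb R^{n\times(n-1)}$, $V\in\mathbb R^{(n-1)\times(n-1)}$, $U^TU=V^TV=I_{n-1}$ and $D$ diagonal with nonnegative entries, and in every such decomposition the diagonal entries of $D$ are positive. Given any such decomposition, let $F=UD^{-1}U^T$ (the Puffer transformation), $Z=F\tilde X$ and $a=F\tilde Y$. Let $\lambda\ge 0$ be such that $|\theta_j^*|\ge 2\lambda$ for every $j\ge 2$ with $\theta_j^*\ne 0$. Then the Lasso problem $$\tilde\beta(\lambda)=\mathop{\mathrm{argmin}}_{b\in\mathbb R^{n-1}}\ \tfrac12\|a-Zb\|_2^2+\lambda\|b\|_1$$ has exactly one solution, and with probability greater than $$1-2n\exp\left\{-\frac{\lambda^2}{8\sigma^2}\right\}$$ it satisfies $\mathrm{sign}(\tilde\beta_j(\lambda))=\mathrm{sign}(\tilde\theta^*_j)$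 for all $j=1,\dots,n-1$. This sign equality holds if and only if the preconditioned fused Lasso estimate $\hat\mu^*=\hat\mu(Y,\tilde\beta(\lambda))$ satisfies $\mathrm{sign}(\hat\mu^*_{i+1}-\hat\mu^*_i)=\mathrm{sign}(\mu^*_{i+1}-\mu^*_i)$ for all $i=1,\dots,n-1$; hence $\hat\mu^*$ recovers the jump pattern of $\mu^*$ with probability greater than the same bound. -/

import Mathlib

open MeasureTheory ProbabilityTheory Matrix

noncomputable section

namespace FusedLasso

/-! The number of observations is `n = m + 1`, so vectors of observations are indexed by
`Fin (m + 1)` and vectors of jumps by `Fin m`. -/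

/-- The average of the entries of a vector. -/
def average {m : ℕ} (u : Fin (m + 1) → ℝ) : ℝ := (∑ i, u i) / ((m + 1 : ℕ) : ℝ)

/-- The centered version `u - ū` of a vector. -/
def center {m : ℕ} (u : Fin (m + 1) → ℝ) : Fin (m + 1) → ℝ := fun i => u i - average u

/-- The `n × n` lower triangular matrix of ones. -/
def matA (m : ℕ) : Matrix (Fin (m + 1)) (Fin (m + 1)) ℝ :=
  Matrix.of fun i j => if j ≤ i then 1 else 0

/-- The `n × (n - 1)` design matrix, with entry `1` for `i > j` and `0` for `i ≤ j`. -/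
def matX (m : ℕ) : Matrix (Fin (m + 1)) (Fin m) ℝ :=
  Matrix.of fun i j => if j.castSucc < i then 1 else 0

/-- The column averages of `matX`. -/
def avgX (m : ℕ) : Fin m → ℝ := fun j => average fun i => matX m i j

/-- The design matrix with centered columns. -/
def matXc (m : ℕ) : Matrix (Fin (m + 1)) (Fin m) ℝ :=
  Matrix.of fun i j => center (fun k => matX m k j) i

/-- `θ = A⁻¹ μ`. -/
def theta {m : ℕ} (μ : Fin (m + 1) → ℝ) : Fin (m + 1) → ℝ := (matA m)⁻¹ *ᵥ μ

/-- The jump vector: `θ` without its first entry. -/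
def thetaTilde {m : ℕ} (μ : Fin (m + 1) → ℝ) : Fin m → ℝ := Fin.tail (theta μ)

/-- The Lasso objective `½ ‖a - Z b‖₂² + lam ‖b‖₁`. -/
def lassoObjective {ι κ : Type*} [Fintype ι] [Fintype κ]
    (Z : Matrix ι κ ℝ) (a : ι → ℝ) (lam : ℝ) (b : κ → ℝ) : ℝ :=
  1 / 2 * ∑ i, (a i - (Z *ᵥ b) i) ^ 2 + lam * ∑ j, |b j|

/-- `b` is a Lasso solution for the data `(Z, a)` with parameter `lam`. -/
def IsLasso {ι κ : Type*} [Fintype ι] [Fintype κ]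
    (Z : Matrix ι κ ℝ) (a : ι → ℝ) (lam : ℝ) (b : κ → ℝ) : Prop :=
  ∀ b' : κ → ℝ, lassoObjective Z a lam b ≤ lassoObjective Z a lam b'

/-- The objective `½ ‖y - μ‖₂² + lam₁ ‖μ‖₁ + lam₂ ‖μ‖_TV` of the fused Lasso signal
approximator. -/
def flsaObjective {m : ℕ} (y : Fin (m + 1) → ℝ) (lam₁ lam₂ : ℝ) (μ : Fin (m + 1) → ℝ) : ℝ :=
  1 / 2 * ∑ i, (y i - μ i) ^ 2 + lam₁ * ∑ i, |μ i|
    + lam₂ * ∑ i : Fin m, |μ i.succ - μ i.castSucc|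

/-- `μ` is a solution of the fused Lasso signal approximator. -/
def IsFLSA {m : ℕ} (y : Fin (m + 1) → ℝ) (lam₁ lam₂ : ℝ) (μ : Fin (m + 1) → ℝ) : Prop :=
  ∀ μ' : Fin (m + 1) → ℝ, flsaObjective y lam₁ lam₂ μ ≤ flsaObjective y lam₁ lam₂ μ'

/-- The signal estimate `A [θ̂₁, b]` with `θ̂₁ = ȳ - X̄ b` that belongs to an estimate `b` of the
jump vector. -/
def signalEstimate {m : ℕ} (y : Fin (m + 1) → ℝ) (b : Fin m → ℝ) : Fin (m + 1) → ℝ :=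
  matA m *ᵥ (Fin.cons (average y - avgX m ⬝ᵥ b) b : Fin (m + 1) → ℝ)

/-- Two vectors have the same signs. -/
def SignEq {κ : Type*} (u v : κ → ℝ) : Prop :=
  ∀ j, SignType.sign (u j) = SignType.sign (v j)

/-- Two signals have the same jump signs. -/
def JumpSignEq {m : ℕ} (μ ν : Fin (m + 1) → ℝ) : Prop :=
  ∀ i : Fin m, SignType.sign (μ i.succ - μ i.castSucc) = SignType.sign (ν i.succ - ν i.castSucc)

/-- `X = U D Vᵀ` with `D = diag d` is a (thin) singular value decomposition, for a matrix with at
least as many rows as columns. -/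
structure IsSVD {ι κ : Type*} [Fintype κ] [Fintype ι] [DecidableEq κ]
    (X : Matrix ι κ ℝ) (U : Matrix ι κ ℝ) (d : κ → ℝ) (V : Matrix κ κ ℝ) : Prop where
  left_orthonormal : Uᵀ * U = 1
  right_orthonormal : Vᵀ * V = 1
  nonneg : ∀ j, 0 ≤ d j
  eq_mul : X = U * Matrix.diagonal d * Vᵀ

/-- The Puffer transformation `F = U D⁻¹ Uᵀ`. -/
def puffer {ι κ : Type*} [Fintype κ] [DecidableEq κ]
    (U : Matrix ι κ ℝ) (d : κ → ℝ) : Matrix ι ι ℝ :=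
  U * (Matrix.diagonal d)⁻¹ * Uᵀ

end FusedLasso

end

/-! Taking jumps inverts `matX` and ignores constants, so every centered vector is exactly `matXc`
applied to its jump vector (`matXc_mulVec_jumps`) and `matXc` is injective.

A signal is determined by its average and its jumps. With `lam₁ = 0` its objective is the centered
Lasso objective at the jumps plus a multiple of the squared error of the average, so the two parts
are minimized separately.

Preconditioning turns the design into `Z = U Vᵀ`, with orthonormal columns, and the response into
`Z` times the jumps of `Y`. The Lasso then decouples into soft thresholding of `θ_j + (ε_{j+1} -
ε_j)`. Noise below `lam` in absolute value cannot spoil a sign when `θ_j` is zero or at least `2 *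
lam` in size. A Gaussian tail bound and a union bound over the `n - 1` jumps give the probability.
-/

namespace FusedLasso

/-- The consecutive differences of a vector. -/
def jumps {m : ℕ} (μ : Fin (m + 1) → ℝ) : Fin m → ℝ := fun i => μ i.succ - μ i.castSucc

/-! ### Jumps, averages and the design matrices -/

lemma matX_mulVec_zero {m : ℕ} (b : Fin m → ℝ) : (matX m *ᵥ b) 0 = 0 := by
  simp [mulVec, dotProduct, matX]

lemma jumps_matX_mulVec {m : ℕ} (b : Fin m → ℝ) : jumps (matX m *ᵥ b) = b := by
  funext i
  simp only [jumps, mulVec, dotProduct, matX, of_apply, ← Finset.sum_sub_distrib]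
  rw [Finset.sum_eq_single i]
  · simp
  · intro j _ hj
    have h : j.castSucc < i.succ ↔ j.castSucc < i.castSucc := by
      simp only [Fin.lt_def, Fin.val_castSucc, Fin.val_succ]
      have := Fin.val_ne_of_ne hj
      omega
    simp [h]
  · simp

lemma eq_of_zero_eq_of_jumps_eq {m : ℕ} {μ ν : Fin (m + 1) → ℝ} (h0 : μ 0 = ν 0)
    (h : jumps μ = jumps ν) : μ = ν := by
  funext i
  induction i using Fin.induction with
  | zero => exact h0
  | succ i ih =>
    have := congrFun h i
    simp only [jumps] at this
    linarith

lemma matX_mulVec_jumps {m : ℕ} (μ : Fin (m + 1) → ℝ) (i : Fin (m + 1)) :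
    (matX m *ᵥ jumps μ) i = μ i - μ 0 := by
  refine congrFun (eq_of_zero_eq_of_jumps_eq (ν := fun i => μ i - μ 0) ?_ ?_) i
  · simp [matX_mulVec_zero]
  · rw [jumps_matX_mulVec]
    funext i
    simp [jumps]

lemma average_matX_mulVec {m : ℕ} (b : Fin m → ℝ) :
    average (matX m *ᵥ b) = avgX m ⬝ᵥ b := by
  simp only [average, avgX, mulVec, dotProduct]
  rw [Finset.sum_comm, Finset.sum_div]
  refine Finset.sum_congr rfl fun j _ => ?_
  rw [← Finset.sum_mul]
  ring

lemma matXc_mulVec {m : ℕ} (b : Fin m → ℝ) : matXc m *ᵥ b = center (matX m *ᵥ b) := by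
  funext i
  rw [center, average_matX_mulVec]
  simp only [matXc, avgX, center, mulVec, dotProduct, of_apply, sub_mul,
    Finset.sum_sub_distrib]

lemma average_const_add {m : ℕ} (c : ℝ) (u : Fin (m + 1) → ℝ) :
    average (fun i => c + u i) = c + average u := by
  have : ((m + 1 : ℕ) : ℝ) ≠ 0 := by positivity
  simp only [average, Finset.sum_add_distrib, Finset.sum_const, Finset.card_univ,
    Fintype.card_fin, nsmul_eq_mul]
  field_simp

lemma sum_eq_mul_average {m : ℕ} (u : Fin (m + 1) → ℝ) :
    ∑ i, u i = ((m + 1 : ℕ) : ℝ) * average u := by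
  have : ((m + 1 : ℕ) : ℝ) ≠ 0 := by positivity
  simp only [average]
  field_simp

lemma matXc_mulVec_jumps {m : ℕ} (μ : Fin (m + 1) → ℝ) :
    matXc m *ᵥ jumps μ = center μ := by
  have h : matX m *ᵥ jumps μ = fun i => -μ 0 + μ i := by
    funext i
    rw [matX_mulVec_jumps]
    ring
  rw [matXc_mulVec, h]
  funext i
  rw [center, average_const_add, center]
  ring

lemma jumps_center {m : ℕ} (μ : Fin (m + 1) → ℝ) : jumps (center μ) = jumps μ := by
  funext i
  simp [jumps, center]

lemma matXc_mulVec_injective (m : ℕ) : Function.Injective (matXc m).mulVec := by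
  intro b c h
  have h' := congrArg jumps h
  simpa only [matXc_mulVec, jumps_center, jumps_matX_mulVec] using h'

lemma matA_mulVec_cons {m : ℕ} (c : ℝ) (b : Fin m → ℝ) :
    matA m *ᵥ (Fin.cons c b : Fin (m + 1) → ℝ) = fun i => c + (matX m *ᵥ b) i := by
  funext i
  have h (j : Fin m) : j.succ ≤ i ↔ j.castSucc < i := by
    simp only [Fin.le_def, Fin.lt_def, Fin.val_succ, Fin.val_castSucc, Nat.succ_le_iff]
  simp only [mulVec, dotProduct, Fin.sum_univ_succ, matA, matX, of_apply, h, Fin.cons_zero,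
    Fin.cons_succ, Fin.zero_le, if_true, one_mul]

lemma det_matA (m : ℕ) : (matA m).det = 1 := by
  rw [det_of_isLowerTriangular]
  · simp [matA]
  · intro i j hij
    have hij' : i < j := hij
    simp [matA, hij']

lemma theta_eq {m : ℕ} (μ : Fin (m + 1) → ℝ) : theta μ = Fin.cons (μ 0) (jumps μ) := by
  have h : matA m *ᵥ (Fin.cons (μ 0) (jumps μ) : Fin (m + 1) → ℝ) = μ := by
    rw [matA_mulVec_cons]
    funext i
    rw [matX_mulVec_jumps]
    ring
  have hA : IsUnit (matA m).det := by simp [det_matA]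
  conv_lhs => rw [theta, ← h, mulVec_mulVec, nonsing_inv_mul _ hA, one_mulVec]

lemma thetaTilde_eq {m : ℕ} (μ : Fin (m + 1) → ℝ) : thetaTilde μ = jumps μ := by
  rw [thetaTilde, theta_eq, Fin.tail_cons]

lemma signalEstimate_eq {m : ℕ} (y : Fin (m + 1) → ℝ) (b : Fin m → ℝ) :
    signalEstimate y b = fun i => (average y - avgX m ⬝ᵥ b) + (matX m *ᵥ b) i :=
  matA_mulVec_cons _ _

lemma jumps_signalEstimate {m : ℕ} (y : Fin (m + 1) → ℝ) (b : Fin m → ℝ) :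
    jumps (signalEstimate y b) = b := by
  rw [signalEstimate_eq]
  conv_rhs => rw [← jumps_matX_mulVec b]
  funext i
  simp [jumps]

lemma average_signalEstimate {m : ℕ} (y : Fin (m + 1) → ℝ) (b : Fin m → ℝ) :
    average (signalEstimate y b) = average y := by
  rw [signalEstimate_eq, average_const_add, average_matX_mulVec]
  ring

lemma eq_of_average_eq_of_jumps_eq {m : ℕ} {μ ν : Fin (m + 1) → ℝ}
    (h : average μ = average ν) (hj : jumps μ = jumps ν) : μ = ν := by
  have hc : center μ = center ν := by rw [← matXc_mulVec_jumps, hj, matXc_mulVec_jumps]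
  funext i
  have := congrFun hc i
  simp only [center, h] at this
  linarith

/-! ### The signal approximator as a centered Lasso -/

/-- Pythagoras: centered vectors are orthogonal to constants. -/
lemma sum_sq_sub_eq {m : ℕ} (y μ : Fin (m + 1) → ℝ) :
    ∑ i, (y i - μ i) ^ 2 = ∑ i, (center y i - center μ i) ^ 2 +
      ((m + 1 : ℕ) : ℝ) * (average y - average μ) ^ 2 := by
  have h : ∀ i, (y i - μ i) ^ 2 = (center y i - center μ i) ^ 2 +
      (2 * (average y - average μ) * (y i - μ i) - (average y - average μ) ^ 2) := by
    intro i
    simp only [center]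
    ring
  rw [Finset.sum_congr rfl fun i _ => h i, Finset.sum_add_distrib, Finset.sum_sub_distrib,
    ← Finset.mul_sum, Finset.sum_sub_distrib, sum_eq_mul_average y, sum_eq_mul_average μ]
  simp only [Finset.sum_const, Finset.card_univ, Fintype.card_fin, nsmul_eq_mul]
  ring

lemma flsaObjective_zero_eq {m : ℕ} (y μ : Fin (m + 1) → ℝ) (lam : ℝ) :
    flsaObjective y 0 lam μ = lassoObjective (matXc m) (center y) lam (jumps μ) +
      ((m + 1 : ℕ) : ℝ) / 2 * (average y - average μ) ^ 2 := by
  rw [flsaObjective, lassoObjective, matXc_mulVec_jumps, sum_sq_sub_eq]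
  simp only [jumps]
  ring

lemma isFLSA_zero_iff {m : ℕ} (y : Fin (m + 1) → ℝ) (lam : ℝ) (μ : Fin (m + 1) → ℝ) :
    IsFLSA y 0 lam μ ↔ ∃ b, IsLasso (matXc m) (center y) lam b ∧ μ = signalEstimate y b := by
  have hpos : (0 : ℝ) < ((m + 1 : ℕ) : ℝ) / 2 := by positivity
  constructor
  · intro h
    have key : ∀ b, lassoObjective (matXc m) (center y) lam (jumps μ) +
        ((m + 1 : ℕ) : ℝ) / 2 * (average y - average μ) ^ 2 ≤
          lassoObjective (matXc m) (center y) lam b := by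
      intro b
      have := h (signalEstimate y b)
      rw [flsaObjective_zero_eq, flsaObjective_zero_eq, jumps_signalEstimate,
        average_signalEstimate] at this
      simpa using this
    refine ⟨jumps μ, fun b => ?_, eq_of_average_eq_of_jumps_eq ?_ ?_⟩
    · have := key b
      have : 0 ≤ ((m + 1 : ℕ) : ℝ) / 2 * (average y - average μ) ^ 2 := by positivity
      linarith
    · have h1 := key (jumps μ)
      have h2 : (average y - average μ) ^ 2 ≤ 0 := by
        by_contra! h3
        have := mul_pos hpos h3
        linarith
      have h3 : average y - average μ = 0 := pow_eq_zero_iff two_ne_zero |>.1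
        (le_antisymm h2 (sq_nonneg _))
      rw [average_signalEstimate]
      linarith
    · rw [jumps_signalEstimate]
  · rintro ⟨b, hb, rfl⟩ μ'
    rw [flsaObjective_zero_eq, flsaObjective_zero_eq, jumps_signalEstimate,
      average_signalEstimate]
    have h1 := hb (jumps μ')
    have h2 : 0 ≤ ((m + 1 : ℕ) : ℝ) / 2 * (average y - average μ') ^ 2 := by positivity
    simp only [sub_self]
    linarith

/-! ### Singular value decompositions and the Puffer transformation -/

section SVD

variable {ι κ : Type*} [Fintype ι] [Fintype κ] [DecidableEq κ] {X U : Matrix ι κ ℝ} {d : κ → ℝ}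
  {V : Matrix κ κ ℝ}

/-- Diagonalize the positive definite Gram matrix as `XᵀX = V diag(e) Vᵀ`; then `d = √e` and `U = X
V D⁻¹` work. -/
lemma exists_isSVD (hX : Function.Injective X.mulVec) : ∃ U d V, IsSVD X U d V := by
  have hpd : (Xᵀ * X).PosDef := by
    simpa using PosDef.conjTranspose_mul_self X hX
  have hH := hpd.isHermitian
  set V : Matrix κ κ ℝ := (hH.eigenvectorUnitary).1 with hV
  set e := hH.eigenvalues with he
  have hepos : ∀ j, 0 < e j := hpd.eigenvalues_pos
  have hVV : Vᵀ * V = 1 := by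
    have := Unitary.coe_star_mul_self hH.eigenvectorUnitary
    simpa [star_eq_conjTranspose] using this
  have hVV' : V * Vᵀ = 1 := mul_eq_one_comm.1 hVV
  have hspec : Vᵀ * (Xᵀ * X) * V = diagonal e := by
    have := hH.conjStarAlgAut_star_eigenvectorUnitary
    rw [Unitary.conjStarAlgAut_star_apply] at this
    simpa [star_eq_conjTranspose] using this
  set d : κ → ℝ := fun j => √(e j) with hd
  have hdpos : ∀ j, 0 < d j := fun j => Real.sqrt_pos.2 (hepos j)
  refine ⟨X * V * diagonal fun j => (d j)⁻¹, d, V, ?_, hVV, fun j => (hdpos j).le, ?_⟩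
  · calc (X * V * diagonal fun j => (d j)⁻¹)ᵀ * (X * V * diagonal fun j => (d j)⁻¹)
        = (diagonal fun j => (d j)⁻¹) * (Vᵀ * (Xᵀ * X) * V) * (diagonal fun j => (d j)⁻¹) := by
          simp only [transpose_mul, diagonal_transpose, Matrix.mul_assoc]
      _ = 1 := by
          rw [hspec, diagonal_mul_diagonal, diagonal_mul_diagonal, ← diagonal_one]
          congr 1
          funext j
          have h1 : e j = d j * d j := (Real.mul_self_sqrt (hepos j).le).symm
          have h2 := (hdpos j).ne'
          rw [h1]
          field_simp
  · have h1 : (diagonal fun j => (d j)⁻¹) * diagonal d = 1 := by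
      rw [diagonal_mul_diagonal, ← diagonal_one]
      congr 1
      funext j
      exact inv_mul_cancel₀ (hdpos j).ne'
    rw [Matrix.mul_assoc (X * V), h1, Matrix.mul_one, Matrix.mul_assoc, hVV', Matrix.mul_one]

/-- A vanishing `d j` would put the nonzero vector `V e_j` in the kernel of `X`. -/
lemma IsSVD.pos (h : IsSVD X U d V) (hX : Function.Injective X.mulVec) (j : κ) : 0 < d j := by
  refine lt_of_le_of_ne (h.nonneg j) fun h0 => ?_
  have h1 : X *ᵥ (V *ᵥ Pi.single j 1) = 0 := by
    rw [h.eq_mul, mulVec_mulVec, Matrix.mul_assoc, h.right_orthonormal, Matrix.mul_one,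
      ← mulVec_mulVec, diagonal_mulVec_single, ← h0]
    simp
  have h2 : V *ᵥ Pi.single j (1 : ℝ) = 0 := hX (by simpa using h1)
  have h3 : (Pi.single j (1 : ℝ) : κ → ℝ) = 0 := by
    rw [← one_mulVec (Pi.single j (1 : ℝ)), ← h.right_orthonormal, ← mulVec_mulVec, h2,
      mulVec_zero]
  simpa using congrFun h3 j

lemma IsSVD.puffer_mul (h : IsSVD X U d V) (hd : ∀ j, 0 < d j) : puffer U d * X = U * Vᵀ := by
  have hdet : IsUnit (diagonal d).det := by
    rw [det_diagonal]
    exact (Finset.prod_pos fun j _ => hd j).ne'.isUnit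
  calc puffer U d * X = U * (diagonal d)⁻¹ * (Uᵀ * U) * diagonal d * Vᵀ := by
        rw [puffer, h.eq_mul]
        simp only [Matrix.mul_assoc]
    _ = U * ((diagonal d)⁻¹ * diagonal d) * Vᵀ := by
        rw [h.left_orthonormal]
        simp only [Matrix.mul_assoc, Matrix.one_mul]
    _ = U * Vᵀ := by rw [nonsing_inv_mul _ hdet, Matrix.mul_one]

lemma IsSVD.puffer_mul_orthonormal (h : IsSVD X U d V) (hd : ∀ j, 0 < d j) :
    (puffer U d * X)ᵀ * (puffer U d * X) = 1 := by
  rw [h.puffer_mul hd, transpose_mul, transpose_transpose, Matrix.mul_assoc,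
    ← Matrix.mul_assoc Uᵀ, h.left_orthonormal, Matrix.one_mul]
  exact mul_eq_one_comm.1 h.right_orthonormal

end SVD

/-! ### The Lasso with an orthonormal design -/

/-- Soft thresholding. -/
noncomputable def softThreshold (lam g : ℝ) : ℝ := if lam < g then g - lam else if g < -lam then g + lam else 0

/-- The quadratic gap, from strong convexity, yields minimality and uniqueness at once. -/
lemma softThreshold_add_sq_le {lam : ℝ} (hlam : 0 ≤ lam) (g t : ℝ) :
    1 / 2 * (g - softThreshold lam g) ^ 2 + lam * |softThreshold lam g|
      + 1 / 2 * (t - softThreshold lam g) ^ 2 ≤ 1 / 2 * (g - t) ^ 2 + lam * |t| := by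
  have h1 : lam * t ≤ lam * |t| := mul_le_mul_of_nonneg_left (le_abs_self t) hlam
  have h2 : lam * -t ≤ lam * |t| := mul_le_mul_of_nonneg_left (neg_le_abs t) hlam
  unfold softThreshold
  split_ifs with hg hg'
  · rw [abs_of_pos (by linarith)]
    linarith
  · rw [abs_of_neg (by linarith)]
    linarith
  · have h3 : |g| ≤ lam := abs_le.2 ⟨by linarith, by linarith⟩
    have h4 : g * t ≤ lam * |t| := by
      calc g * t ≤ |g * t| := le_abs_self _
        _ = |g| * |t| := abs_mul _ _
        _ ≤ lam * |t| := by gcongr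
    rw [abs_zero]
    linarith

lemma sign_softThreshold {lam θ η : ℝ} (hη : |η| < lam) (hθ : θ ≠ 0 → 2 * lam ≤ |θ|) :
    SignType.sign (softThreshold lam (θ + η)) = SignType.sign θ := by
  obtain ⟨h1, h2⟩ := abs_lt.1 hη
  unfold softThreshold
  rcases lt_trichotomy θ 0 with h | h | h
  · have h3 := hθ h.ne
    rw [abs_of_neg h] at h3
    rw [if_neg (by linarith), if_pos (by linarith), sign_neg h, sign_neg (by linarith)]
  · subst h
    rw [if_neg (by linarith), if_neg (by linarith)]
  -- Here `θ + η > 2 * lam - lam = lam`, so thresholding leaves a positive value.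
  · have h3 := hθ h.ne'
    rw [abs_of_pos h] at h3
    rw [if_pos (by linarith), sign_pos h, sign_pos (by linarith)]

section Orthonormal

variable {ι κ : Type*} [Fintype ι] [Fintype κ] [DecidableEq κ] {Z : Matrix ι κ ℝ}

lemma lassoObjective_mulVec_of_orthonormal (hZ : Zᵀ * Z = 1) (g : κ → ℝ) (lam : ℝ) (b : κ → ℝ) :
    lassoObjective Z (Z *ᵥ g) lam b = ∑ j, (1 / 2 * (g j - b j) ^ 2 + lam * |b j|) := by
  have h : ∑ i, ((Z *ᵥ g) i - (Z *ᵥ b) i) ^ 2 = ∑ j, (g j - b j) ^ 2 := by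
    calc ∑ i, ((Z *ᵥ g) i - (Z *ᵥ b) i) ^ 2 = (Z *ᵥ (g - b)) ⬝ᵥ (Z *ᵥ (g - b)) := by
          simp [mulVec_sub, dotProduct, sq]
      _ = (g - b) ⬝ᵥ (g - b) := by
          rw [dotProduct_mulVec, ← mulVec_transpose, mulVec_mulVec, hZ, one_mulVec]
      _ = ∑ j, (g j - b j) ^ 2 := by simp [dotProduct, sq]
  rw [lassoObjective, h, Finset.sum_add_distrib, Finset.mul_sum, Finset.mul_sum]

lemma isLasso_mulVec_iff_of_orthonormal (hZ : Zᵀ * Z = 1) (g : κ → ℝ) {lam : ℝ} (hlam : 0 ≤ lam)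
    (b : κ → ℝ) :
    IsLasso Z (Z *ᵥ g) lam b ↔ b = fun j => softThreshold lam (g j) := by
  set s : κ → ℝ := fun j => softThreshold lam (g j) with hs
  have key : ∀ b, lassoObjective Z (Z *ᵥ g) lam s + ∑ j, 1 / 2 * (b j - s j) ^ 2 ≤
      lassoObjective Z (Z *ᵥ g) lam b := by
    intro b
    rw [lassoObjective_mulVec_of_orthonormal hZ, lassoObjective_mulVec_of_orthonormal hZ,
      ← Finset.sum_add_distrib]
    exact Finset.sum_le_sum fun j _ => softThreshold_add_sq_le hlam (g j) (b j)
  constructor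
  · intro h
    have h1 : ∑ j, 1 / 2 * (b j - s j) ^ 2 = 0 :=
      le_antisymm (by linarith [key b, h s]) (Finset.sum_nonneg fun j _ => by positivity)
    rw [Finset.sum_eq_zero_iff_of_nonneg fun j _ => by positivity] at h1
    funext j
    have h2 := h1 j (Finset.mem_univ j)
    have h3 : b j - s j = 0 := by simpa using h2
    linarith
  · rintro rfl b'
    have h1 : 0 ≤ ∑ j, 1 / 2 * (b' j - s j) ^ 2 := Finset.sum_nonneg fun j _ => by positivity
    linarith [key b']

end Orthonormal

/-! ### Gaussian tails -/

section Tails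

variable {Ω : Type*} [MeasurableSpace Ω] {P : Measure Ω}

/-- Lets noise differences be bounded by adding sub-Gaussian parameters, without computing their
law. -/
lemma hasSubgaussianMGF_of_hasLaw_gaussianReal {X : Ω → ℝ} {v : NNReal}
    (hX : HasLaw X (gaussianReal 0 v) P) : HasSubgaussianMGF X v P where
  integrable_exp_mul t := by
    have h := integrable_exp_mul_gaussianReal (μ := 0) (v := v) t
    rw [← hX.map_eq] at h
    exact (integrable_map_measure h.aestronglyMeasurable hX.aemeasurable).1 h
  mgf_le t := by
    rw [mgf_gaussianReal hX.map_eq]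
    simp

lemma measureReal_le_abs_le_of_hasSubgaussianMGF [IsFiniteMeasure P] {X : Ω → ℝ} {c : NNReal}
    (hX : HasSubgaussianMGF X c P) {t : ℝ} (ht : 0 ≤ t) :
    P.real {ω | t ≤ |X ω|} ≤ 2 * Real.exp (-t ^ 2 / (2 * c)) := by
  have hsub : {ω | t ≤ |X ω|} ⊆ {ω | t ≤ X ω} ∪ {ω | t ≤ (-X) ω} := by
    intro ω hω
    simpa [le_abs] using hω
  calc P.real {ω | t ≤ |X ω|} ≤ P.real ({ω | t ≤ X ω} ∪ {ω | t ≤ (-X) ω}) :=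
        measureReal_mono hsub
    _ ≤ P.real {ω | t ≤ X ω} + P.real {ω | t ≤ (-X) ω} := measureReal_union_le _ _
    _ ≤ 2 * Real.exp (-t ^ 2 / (2 * c)) := by
        linarith [hX.measure_ge_le ht, hX.neg.measure_ge_le ht]

/-- Neighbouring jumps share a noise term and are dependent, hence a union bound. At `lam = 0` the
event may be empty, but the left side is negative. -/
lemma lt_measureReal_forall_abs_jumps_lt [IsProbabilityMeasure P] {m : ℕ} {σ : ℝ}
    {ε : Fin (m + 1) → Ω → ℝ} (hindep : iIndepFun ε P)
    (hlaw : ∀ i, HasLaw (ε i) (gaussianReal 0 (Real.toNNReal (σ ^ 2))) P)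
    {lam : ℝ} (hlam : 0 ≤ lam) :
    1 - 2 * ((m + 1 : ℕ) : ℝ) * Real.exp (-(lam ^ 2 / (8 * σ ^ 2))) <
      P.real {ω | ∀ j, |jumps (fun i => ε i ω) j| < lam} := by
  have htail : ∀ j : Fin m, P.real {ω | lam ≤ |jumps (fun i => ε i ω) j|} ≤
      2 * Real.exp (-(lam ^ 2 / (8 * σ ^ 2))) := by
    intro j
    have hind : IndepFun (ε j.succ) (ε j.castSucc) P :=
      hindep.indepFun (Fin.castSucc_lt_succ).ne'
    have h := measureReal_le_abs_le_of_hasSubgaussianMGF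
      ((hasSubgaussianMGF_of_hasLaw_gaussianReal (hlaw j.succ)).sub_of_indepFun
        (hasSubgaussianMGF_of_hasLaw_gaussianReal (hlaw j.castSucc)) hind) hlam
    refine h.trans ?_
    have hc : ((Real.toNNReal (σ ^ 2) + Real.toNNReal (σ ^ 2) : NNReal) : ℝ) = 2 * σ ^ 2 := by
      rw [NNReal.coe_add, Real.coe_toNNReal _ (sq_nonneg σ)]
      ring
    rw [hc]
    gcongr
    have h1 : 0 ≤ lam ^ 2 / (8 * σ ^ 2) := by positivity
    -- The difference has variance parameter `2 * σ ^ 2`, so the true exponent is twice the claimed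
    -- one.
    have h2 : -lam ^ 2 / (2 * (2 * σ ^ 2)) = -(2 * (lam ^ 2 / (8 * σ ^ 2))) := by ring
    rw [h2]
    linarith
  have hcover : (Set.univ : Set Ω) ⊆ {ω | ∀ j, |jumps (fun i => ε i ω) j| < lam} ∪
      ⋃ j : Fin m, {ω | lam ≤ |jumps (fun i => ε i ω) j|} := by
    intro ω _
    by_cases h : ∀ j, |jumps (fun i => ε i ω) j| < lam
    · exact Or.inl h
    · push Not at h
      exact Or.inr (Set.mem_iUnion.2 h)
  have h1 : (1 : ℝ) ≤ P.real {ω | ∀ j, |jumps (fun i => ε i ω) j| < lam} +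
      ∑ j : Fin m, P.real {ω | lam ≤ |jumps (fun i => ε i ω) j|} := by
    calc (1 : ℝ) = P.real Set.univ := by simp
      _ ≤ _ := measureReal_mono hcover
      _ ≤ _ := measureReal_union_le _ _
      _ ≤ _ := by gcongr; exact measureReal_iUnion_fintype_le _
  have h2 : ∑ j : Fin m, P.real {ω | lam ≤ |jumps (fun i => ε i ω) j|} ≤
      m * (2 * Real.exp (-(lam ^ 2 / (8 * σ ^ 2)))) := by
    refine (Finset.sum_le_sum fun j _ => htail j).trans_eq ?_
    simp
  -- Strictness comes from `m < m + 1` failure terms, each positive.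
  have h3 := Real.exp_pos (-(lam ^ 2 / (8 * σ ^ 2)))
  push_cast
  linarith

end Tails

end FusedLasso

theorem theorem4p2 {Ω : Type*} [MeasurableSpace Ω] (P : Measure Ω) [IsProbabilityMeasure P]
    (m : ℕ) (μs : Fin (m + 1) → ℝ) (σ : ℝ) (hσ : 0 < σ)
    (ε : Fin (m + 1) → Ω → ℝ) (hindep : iIndepFun ε P)
    (hlaw : ∀ i, HasLaw (ε i) (gaussianReal 0 (Real.toNNReal (σ ^ 2))) P)
    (Y : Ω → Fin (m + 1) → ℝ) (hY : ∀ ω i, Y ω i = μs i + ε i ω)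
    (lam : ℝ) (hlam : 0 ≤ lam)
    (hjump : ∀ j, FusedLasso.thetaTilde μs j ≠ 0 → 2 * lam ≤ |FusedLasso.thetaTilde μs j|) :
    -- the signal approximator with `λ₁ = 0` is the centered Lasso
    (∀ (y : Fin (m + 1) → ℝ) (lam₂ : ℝ), 0 ≤ lam₂ → ∀ μ : Fin (m + 1) → ℝ,
      FusedLasso.IsFLSA y 0 lam₂ μ ↔
        ∃ b, FusedLasso.IsLasso (FusedLasso.matXc m) (FusedLasso.center y) lam₂ b ∧
          μ = FusedLasso.signalEstimate y b) ∧
    -- the centered design has a singular value decomposition, with invertible `D`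
    (∃ U d V, FusedLasso.IsSVD (FusedLasso.matXc m) U d V) ∧
    ∀ U d V, FusedLasso.IsSVD (FusedLasso.matXc m) U d V →
      (∀ j, 0 < d j) ∧
      -- the preconditioned Lasso has exactly one solution
      (∀ ω, ∃! b, FusedLasso.IsLasso (FusedLasso.puffer U d * FusedLasso.matXc m)
        (FusedLasso.puffer U d *ᵥ FusedLasso.center (Y ω)) lam b) ∧
      ∀ β : Ω → Fin m → ℝ,
        (∀ ω, FusedLasso.IsLasso (FusedLasso.puffer U d * FusedLasso.matXc m)
          (FusedLasso.puffer U d *ᵥ FusedLasso.center (Y ω)) lam (β ω)) →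
        1 - 2 * ((m + 1 : ℕ) : ℝ) * Real.exp (-(lam ^ 2 / (8 * σ ^ 2))) <
            P.real {ω | FusedLasso.SignEq (β ω) (FusedLasso.thetaTilde μs)} ∧
        (∀ ω, FusedLasso.SignEq (β ω) (FusedLasso.thetaTilde μs) ↔
          FusedLasso.JumpSignEq (FusedLasso.signalEstimate (Y ω) (β ω)) μs) ∧
        1 - 2 * ((m + 1 : ℕ) : ℝ) * Real.exp (-(lam ^ 2 / (8 * σ ^ 2))) <
            P.real {ω | FusedLasso.JumpSignEq
              (FusedLasso.signalEstimate (Y ω) (β ω)) μs} := by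
  have hinj := FusedLasso.matXc_mulVec_injective m
  refine ⟨fun y lam₂ _ μ => FusedLasso.isFLSA_zero_iff y lam₂ μ, FusedLasso.exists_isSVD hinj,
    fun U d V h => ?_⟩
  have hd := h.pos hinj
  have hLasso : ∀ ω b, FusedLasso.IsLasso (FusedLasso.puffer U d * FusedLasso.matXc m)
      (FusedLasso.puffer U d *ᵥ FusedLasso.center (Y ω)) lam b ↔
        b = fun j => FusedLasso.softThreshold lam (FusedLasso.jumps (Y ω) j) := by
    intro ω b
    -- The centered data lie in the column space, so the preconditioned response is `Z` applied to
    -- the jumps of `Y`, with no residual.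
    rw [← FusedLasso.matXc_mulVec_jumps, mulVec_mulVec]
    exact FusedLasso.isLasso_mulVec_iff_of_orthonormal (h.puffer_mul_orthonormal hd) _ hlam b
  refine ⟨hd, fun ω => ⟨_, (hLasso ω _).2 rfl, fun b hb => (hLasso ω b).1 hb⟩, fun β hβ => ?_⟩
  have hprob : 1 - 2 * ((m + 1 : ℕ) : ℝ) * Real.exp (-(lam ^ 2 / (8 * σ ^ 2))) <
      P.real {ω | FusedLasso.SignEq (β ω) (FusedLasso.thetaTilde μs)} := by
    refine (FusedLasso.lt_measureReal_forall_abs_jumps_lt hindep hlaw hlam).trans_le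
      (measureReal_mono fun ω hω j => ?_)
    have hYj : FusedLasso.jumps (Y ω) j =
        FusedLasso.thetaTilde μs j + FusedLasso.jumps (fun i => ε i ω) j := by
      rw [FusedLasso.thetaTilde_eq]
      simp only [FusedLasso.jumps, hY]
      ring
    rw [(hLasso ω _).1 (hβ ω)]
    beta_reduce
    rw [hYj]
    exact FusedLasso.sign_softThreshold (hω j) (hjump j)
  have hiff : ∀ ω, FusedLasso.SignEq (β ω) (FusedLasso.thetaTilde μs) ↔
      FusedLasso.JumpSignEq (FusedLasso.signalEstimate (Y ω) (β ω)) μs := by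
    intro ω
    rw [FusedLasso.thetaTilde_eq]
    -- The jumps of the signal estimate are `β ω` itself, which makes both sign conditions
    -- definitionally equal.
    conv_lhs => rw [← FusedLasso.jumps_signalEstimate (Y ω) (β ω)]
    rfl
  refine ⟨hprob, hiff, ?_⟩
  simpa only [hiff] using hprob
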